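/- Let $\kappa$ be a field and $\mathbb{N}=\{0,1,2,\dots\}$. Let $S_1=\langle s_1,\dots,s_n\rangle$ and $S_2=\langle t_1,\dots,t_m\rangle$ be finitely generated submonoids of $\mathbb{N}^d$ (such monoids are exactly the affine semigroups in $\mathbb{N}^d$, and they are automatically positive, i.e. contain no nontrivial subgroup). For a submonoid $S\subseteq\mathbb{N}^d$ put $aS=\{as\mid s\in S\}$, let $\mathrm{gp}(S)$ be the subgroup of $\mathbb{Z}^d$ generated by $S$, and let $\kappa[\mathbf{u}^S]\subseteq\kappa[u_1,\dots,u_d]$ be the $\kappa$-algebra generated by the monomials $\mathbf{u}^s$, $s\in S$. Say that $S_1$ and $S_2$ *can be glued* if there are positive integers $a,b$ and monomials $X^p=X_1^{p_1}\cdots X_n^{p_n}$, $Y^q=Y_1^{q_1}\cdots Y_m^{q_m}$ such that the $\kappa$-algebra homomorphisms $$\varphi_1:\kappa[X_1,\dots,X_n]\to\kappa[\mathbf{u}^{aS_1}],\quad \varphi_2:\kappa[Y_1,\dots,Y_m]\to\kappa[\mathbf{u}^{bS_2}],\quad \varphi:\kappa[X_1,\dots,X_n,Y_1,\dots,Y_m]\to\kappa[\mathbf{u}^{aS_1+bS_2}]$$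 given by $\varphi(X_i)=\varphi_1(X_i)=\mathbf{u}^{as_i}$ and $\varphi(Y_j)=\varphi_2(Y_j)=\mathbf{u}^{bt_j}$ satisfy $\varphi_1(X^p)\neq 1$ and $$\ker\varphi=\ker\varphi_1+\ker\varphi_2+\langle X^p-Y^q\rangle$$ as ideals of $\kappa[X_1,\dots,X_n,Y_1,\dots,Y_m]$, where $\ker\varphi_1$ and $\ker\varphi_2$ stand for the ideals they generate there. **Theorem.** For every field $\kappa$ and every choice of generators $s_1,\dots,s_n$ of $S_1$ and $t_1,\dots,t_m$ of $S_2$, the semigroups $S_1$ and $S_2$ can be glued if and only if there are $a,b\in\mathbb{N}$ and a nonzero element $w\in aS_1\cap bS_2$ such that $w$ generates the group $\mathrm{gp}(aS_1)\cap\mathrm{gp}(bS_2)\subseteq\mathbb{Z}^d$. -/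

import Mathlib

namespace Gluing

open MvPolynomial

/-- The exponent lattice inclusion `ℕ^d → ℤ^d`. -/
noncomputable def toInt (d : ℕ) : (Fin d →₀ ℕ) →+ (Fin d →₀ ℤ) :=
  Finsupp.mapRange.addMonoidHom (Nat.castAddMonoidHom ℤ)

/-- The rescaling `aS = {a s | s ∈ S}` of a submonoid `S` of `ℕ^d`. -/
noncomputable def scale {d : ℕ} (a : ℕ) (S : AddSubmonoid (Fin d →₀ ℕ)) : AddSubmonoid (Fin d →₀ ℕ) :=
  S.map (nsmulAddMonoidHom a)

/-- The group of differences `gp(S)`, as a subgroup of `ℤ^d`. -/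
noncomputable def gp {d : ℕ} (S : AddSubmonoid (Fin d →₀ ℕ)) : AddSubgroup (Fin d →₀ ℤ) :=
  AddSubgroup.closure (toInt d '' (S : Set (Fin d →₀ ℕ)))

/-- The semigroup ring `κ[u^S]` inside the polynomial ring `κ[u] = κ[u_1, …, u_d]`: the subalgebra
generated by the monomials `u^s` with `s ∈ S`. -/
noncomputable def semigroupRing (κ : Type*) [Field κ] {d : ℕ} (S : AddSubmonoid (Fin d →₀ ℕ)) :
    Subalgebra κ (MvPolynomial (Fin d) κ) :=
  Algebra.adjoin κ ((fun s => monomial s (1 : κ)) '' (S : Set (Fin d →₀ ℕ)))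

/-- For a family `g` of vectors in `ℕ^d` generating the monoid `⟨g⟩`, the `κ`-algebra homomorphism
`κ[X_i : i ∈ ι] → κ[u^⟨g⟩]` that sends `X_i` to `u^(g i)`. -/
noncomputable def presentation (κ : Type*) [Field κ] {d : ℕ} {ι : Type*}
    (g : ι → (Fin d →₀ ℕ)) :
    MvPolynomial ι κ →ₐ[κ] semigroupRing κ (AddSubmonoid.closure (Set.range g)) :=
  aeval fun i => ⟨monomial (g i) 1,
    Algebra.subset_adjoin ⟨g i, AddSubmonoid.subset_closure ⟨i, rfl⟩, rfl⟩⟩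

/-- The semigroups `⟨s_1, …, s_n⟩` and `⟨t_1, …, t_m⟩` in `ℕ^d` can be glued (over `κ`): for some
positive integers `a, b`, with `φ₁ : X_i ↦ u^(a s_i)`, `φ₂ : Y_j ↦ u^(b t_j)` and `φ` the common
extension to `κ[X, Y]`, one has `ker φ = ker φ₁ + ker φ₂ + ⟨X^p - Y^q⟩` as ideals of `κ[X, Y]`, for
some monomials `X^p` and `Y^q`.  The element `φ₁(X^p)` along which the rings are glued is
a nonconstant monomial in `u`, i.e. it generates a polynomial ring in one variable. -/
def CanBeGlued (κ : Type*) [Field κ] {d n m : ℕ}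
    (s : Fin n → (Fin d →₀ ℕ)) (t : Fin m → (Fin d →₀ ℕ)) : Prop :=
  ∃ a b : ℕ, 0 < a ∧ 0 < b ∧ ∃ (p : Fin n →₀ ℕ) (q : Fin m →₀ ℕ),
    presentation κ (fun i => a • s i) (monomial p 1) ≠ 1 ∧
    RingHom.ker (presentation κ (Sum.elim (fun i => a • s i) (fun j => b • t j))) =
      (RingHom.ker (presentation κ (fun i => a • s i))).map
          (rename (Sum.inl : Fin n → Fin n ⊕ Fin m) : MvPolynomial (Fin n) κ →ₐ[κ] _)
      + (RingHom.ker (presentation κ (fun j => b • t j))).map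
          (rename (Sum.inr : Fin m → Fin n ⊕ Fin m) : MvPolynomial (Fin m) κ →ₐ[κ] _)
      + Ideal.span {rename Sum.inl (monomial p (1 : κ)) - rename Sum.inr (monomial q (1 : κ))}

end Gluing

/-!
Write `φ` for the map `X_i ↦ u^(g₁ i)`, `Y_j ↦ u^(g₂ j)`. Toric ideals are generated by binomials,
so `ker φ` records the coincidences `deg u + deg v = deg u' + deg v'` between exponents `(u, v)` and
`(u', v')`. Each such coincidence yields the element `deg u - deg u' = deg v' - deg v` of the
intersection of the two groups. If `w = deg p = deg q` generates the intersection, this element is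
a multiple `k w`, and `X^u Y^v - X^u' Y^v'` can be reduced to zero by exchanging `(X^p)^k` for
`(Y^q)^k`. Conversely, give `X_i` the degree `g₁ i` modulo `w` and `Y_j` the degree `0`: the
generators of the glued ideal are homogeneous for this grading, so if that ideal is all of `ker φ`,
then every coincidence satisfies `deg u ≡ deg u'` modulo `w`.
-/

namespace Gluing

open MvPolynomial
open Finsupp (sumElim weight)

variable {ι ι₁ ι₂ M N G : Type*} [AddCommMonoid M] [AddCommMonoid N] [AddCommGroup G]

section Weight

theorem weight_comp (f : M →+ N) (g : ι → M) (c : ι →₀ ℕ) :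
    weight (f ∘ g) c = f (weight g c) := by
  simp only [Finsupp.weight_apply, map_finsuppSum, map_nsmul, Function.comp_apply]

theorem weight_sumElim {S : Type*} [Semiring S] [Module S M] (g₁ : ι₁ → M) (g₂ : ι₂ → M)
    (u : ι₁ →₀ S) (v : ι₂ →₀ S) :
    weight (Sum.elim g₁ g₂) (sumElim u v) = weight g₁ u + weight g₂ v :=
  Finsupp.sum_sumElim ..

theorem mem_closure_range_iff_exists_weight_sub (g : ι → G) (z : G) :
    z ∈ AddSubgroup.closure (Set.range g) ↔ ∃ c c' : ι →₀ ℕ, weight g c - weight g c' = z := by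
  rw [← AddSubgroup.mem_toAddSubmonoid, AddSubgroup.closure_toAddSubmonoid,
    AddSubmonoid.closure_union, AddSubmonoid.mem_sup]
  simp only [AddSubmonoid.closure_neg, AddSubmonoid.mem_neg, AddSubmonoid.mem_closure_range_iff,
    ← Finsupp.weight_apply]
  constructor
  · rintro ⟨_, ⟨c, rfl⟩, y, ⟨c', hc'⟩, rfl⟩
    exact ⟨c, c', by rw [← hc', sub_neg_eq_add]⟩
  · rintro ⟨c, c', rfl⟩
    exact ⟨_, ⟨c, rfl⟩, _, ⟨c', neg_neg _⟩, (sub_eq_add_neg _ _).symm⟩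

end Weight

section ToricHom

variable (R : Type*) [CommSemiring R]

theorem monomial_sumElim (u : ι₁ →₀ ℕ) (v : ι₂ →₀ ℕ) :
    monomial (sumElim u v) (1 : R) =
      rename Sum.inl (monomial u 1) * rename Sum.inr (monomial v 1) := by
  rw [rename_monomial, rename_monomial, monomial_mul, one_mul, Finsupp.sumElim_eq_add]

theorem monomial_add_nsmul (c e : ι →₀ ℕ) (k : ℕ) :
    monomial (c + k • e) (1 : R) = monomial c 1 * monomial e 1 ^ k := by
  rw [monomial_pow, one_pow, monomial_mul, one_mul]

/-- The homomorphism `R[X_i : i ∈ ι] → R[M]`, `X_i ↦ u^(g i)`, into the algebra of a commutative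
monoid `M`, for a family `g` of elements of `M`. -/
noncomputable def toricHom (g : ι → M) : MvPolynomial ι R →ₐ[R] AddMonoidAlgebra R M :=
  aeval fun i => AddMonoidAlgebra.single (g i) 1

variable {R}

theorem toricHom_monomial (g : ι → M) (c : ι →₀ ℕ) (r : R) :
    toricHom R g (monomial c r) = AddMonoidAlgebra.single (weight g c) r := by
  simp [toricHom, aeval_monomial, Finsupp.prod, Finsupp.weight_apply, Finsupp.sum,
    AddMonoidAlgebra.single_pow]

theorem toricHom_elim_rename_inl (g₁ : ι₁ → M) (g₂ : ι₂ → M) (f : MvPolynomial ι₁ R) :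
    toricHom R (Sum.elim g₁ g₂) (rename Sum.inl f) = toricHom R g₁ f :=
  aeval_rename ..

theorem toricHom_elim_rename_inr (g₁ : ι₁ → M) (g₂ : ι₂ → M) (f : MvPolynomial ι₂ R) :
    toricHom R (Sum.elim g₁ g₂) (rename Sum.inr f) = toricHom R g₂ f :=
  aeval_rename ..

end ToricHom

section ToricIdeal

variable (R : Type*) [CommRing R]

/-- The toric ideal of the family `g`: the relations among the `u^(g i)` in the monoid algebra. -/
noncomputable def toricIdeal (g : ι → M) : Ideal (MvPolynomial ι R) :=
  RingHom.ker (toricHom R g)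

variable {R}

theorem monomial_sub_monomial_mem_toricIdeal {g : ι → M} {c c' : ι →₀ ℕ}
    (h : weight g c = weight g c') : monomial c (1 : R) - monomial c' 1 ∈ toricIdeal R g := by
  rw [toricIdeal, RingHom.mem_ker, map_sub, toricHom_monomial, toricHom_monomial, h, sub_self]

theorem monomial_sub_monomial_mem_toricIdeal_iff [Nontrivial R] {g : ι → M} {c c' : ι →₀ ℕ} :
    monomial c (1 : R) - monomial c' 1 ∈ toricIdeal R g ↔ weight g c = weight g c' := by
  rw [toricIdeal, RingHom.mem_ker, map_sub, toricHom_monomial, toricHom_monomial, sub_eq_zero,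
    AddMonoidAlgebra.single_left_inj one_ne_zero]

theorem toricIdeal_le_iff {g : ι → M} {I : Ideal (MvPolynomial ι R)} :
    toricIdeal R g ≤ I ↔
      ∀ c c', weight g c = weight g c' → monomial c (1 : R) - monomial c' 1 ∈ I := by
  refine ⟨fun hI c c' h => hI (monomial_sub_monomial_mem_toricIdeal h), fun hI f hf => ?_⟩
  -- Replace each monomial by the chosen representative of its degree: modulo `I` this changes
  -- nothing, while the result depends only on the image of the polynomial in `R[M]`.
  let rep : M → ι →₀ ℕ := Function.invFun (weight g)
  have sub_rep_mem (f : MvPolynomial ι R) :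
      f - (toricHom R g f).mapDomain rep ∈ I := by
    induction f using MvPolynomial.induction_on' with
    | monomial c r =>
      have hrep : weight g c = weight g (rep (weight g c)) :=
        (Function.invFun_eq ⟨c, rfl⟩).symm
      have := I.mul_mem_left (C r) (hI c _ hrep)
      rw [mul_sub, C_mul_monomial, C_mul_monomial, mul_one] at this
      rwa [toricHom_monomial, AddMonoidAlgebra.mapDomain_single]
    | add f₁ f₂ h₁ h₂ =>
      rw [map_add, AddMonoidAlgebra.mapDomain_add, add_sub_add_comm]
      exact I.add_mem h₁ h₂
  have := sub_rep_mem f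
  rwa [RingHom.mem_ker.1 hf, AddMonoidAlgebra.mapDomain_zero, sub_zero] at this

theorem toricIdeal_le_toricIdeal_comp (f : M →+ N) (g : ι → M) :
    toricIdeal R g ≤ toricIdeal R (f ∘ g) :=
  toricIdeal_le_iff.2 fun c c' h =>
    monomial_sub_monomial_mem_toricIdeal (by rw [weight_comp, weight_comp, h])

theorem toricIdeal_comp_of_injective {f : M →+ N} (hf : Function.Injective f) (g : ι → M) :
    toricIdeal R (f ∘ g) = toricIdeal R g := by
  refine le_antisymm (toricIdeal_le_iff.2 fun c c' h => ?_) (toricIdeal_le_toricIdeal_comp f g)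
  rw [weight_comp, weight_comp] at h
  exact monomial_sub_monomial_mem_toricIdeal (hf h)

variable (R) in
/-- The ideal `ker φ₁ + ker φ₂ + ⟨X^p - Y^q⟩` of `R[X, Y]`, where `ker φ₁` and `ker φ₂` are the
toric ideals of `g₁` and `g₂`. -/
noncomputable def gluedIdeal (g₁ : ι₁ → M) (g₂ : ι₂ → M) (p : ι₁ →₀ ℕ) (q : ι₂ →₀ ℕ) :
    Ideal (MvPolynomial (ι₁ ⊕ ι₂) R) :=
  (toricIdeal R g₁).map (rename Sum.inl : MvPolynomial ι₁ R →ₐ[R] _)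
    + (toricIdeal R g₂).map (rename Sum.inr : MvPolynomial ι₂ R →ₐ[R] _)
    + Ideal.span {rename Sum.inl (monomial p (1 : R)) - rename Sum.inr (monomial q (1 : R))}

theorem gluedIdeal_le_iff {g₁ : ι₁ → M} {g₂ : ι₂ → M} {p : ι₁ →₀ ℕ} {q : ι₂ →₀ ℕ}
    {I : Ideal (MvPolynomial (ι₁ ⊕ ι₂) R)} :
    gluedIdeal R g₁ g₂ p q ≤ I ↔
      (∀ f ∈ toricIdeal R g₁, rename Sum.inl f ∈ I) ∧
      (∀ f ∈ toricIdeal R g₂, rename Sum.inr f ∈ I) ∧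
      rename Sum.inl (monomial p (1 : R)) - rename Sum.inr (monomial q (1 : R)) ∈ I := by
  rw [gluedIdeal, Submodule.add_eq_sup, Submodule.add_eq_sup, sup_le_iff, sup_le_iff,
    Ideal.map_le_iff_le_comap, Ideal.map_le_iff_le_comap, Ideal.span_singleton_le_iff_mem,
    and_assoc]
  rfl

theorem gluedIdeal_le_toricIdeal_elim_comp {g₁ : ι₁ → M} {g₂ : ι₂ → M} {p : ι₁ →₀ ℕ}
    {q : ι₂ →₀ ℕ} (f₁ f₂ : M →+ N) (h : f₁ (weight g₁ p) = f₂ (weight g₂ q)) :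
    gluedIdeal R g₁ g₂ p q ≤ toricIdeal R (Sum.elim (f₁ ∘ g₁) (f₂ ∘ g₂)) := by
  refine gluedIdeal_le_iff.2 ⟨fun x hx => ?_, fun x hx => ?_, ?_⟩ <;>
    rw [toricIdeal, RingHom.mem_ker]
  · rw [toricHom_elim_rename_inl]
    exact toricIdeal_le_toricIdeal_comp f₁ g₁ hx
  · rw [toricHom_elim_rename_inr]
    exact toricIdeal_le_toricIdeal_comp f₂ g₂ hx
  · rw [map_sub, toricHom_elim_rename_inl, toricHom_elim_rename_inr, toricHom_monomial,
      toricHom_monomial, weight_comp, weight_comp, h, sub_self]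

theorem weight_eq_of_gluedIdeal_le [Nontrivial R] {g₁ : ι₁ → M} {g₂ : ι₂ → M} {p : ι₁ →₀ ℕ}
    {q : ι₂ →₀ ℕ} (h : gluedIdeal R g₁ g₂ p q ≤ toricIdeal R (Sum.elim g₁ g₂)) :
    weight g₁ p = weight g₂ q := by
  have hpq := (gluedIdeal_le_iff.1 h).2.2
  rwa [toricIdeal, RingHom.mem_ker, map_sub, toricHom_elim_rename_inl, toricHom_elim_rename_inr,
    toricHom_monomial, toricHom_monomial, sub_eq_zero,
    AddMonoidAlgebra.single_left_inj one_ne_zero] at hpq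

theorem monomial_sub_monomial_mem_gluedIdeal {g₁ : ι₁ → M} {g₂ : ι₂ → M} {p u u' : ι₁ →₀ ℕ}
    {q v v' : ι₂ →₀ ℕ} (k : ℕ) (hu : weight g₁ u = weight g₁ u' + k • weight g₁ p)
    (hv : weight g₂ v' = weight g₂ v + k • weight g₂ q) :
    monomial (sumElim u v) (1 : R) - monomial (sumElim u' v') 1 ∈ gluedIdeal R g₁ g₂ p q := by
  obtain ⟨hX, hY, hXY⟩ := gluedIdeal_le_iff.1 (le_refl (gluedIdeal R g₁ g₂ p q))
  rw [← map_nsmul, ← map_add] at hu hv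
  replace hX := hX _ (monomial_sub_monomial_mem_toricIdeal hu)
  replace hY := hY _ (monomial_sub_monomial_mem_toricIdeal hv)
  rw [← Ideal.Quotient.eq_zero_iff_mem] at hX hY hXY ⊢
  simp only [monomial_sumElim, monomial_add_nsmul, map_sub, map_mul, map_pow, sub_eq_zero]
    at hX hY hXY ⊢
  rw [hX, hY, hXY]
  ring

theorem toricIdeal_elim_le_gluedIdeal {g₁ : ι₁ → G} {g₂ : ι₂ → G} {p : ι₁ →₀ ℕ} {q : ι₂ →₀ ℕ}
    (hpq : weight g₁ p = weight g₂ q)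
    (h : AddSubgroup.closure (Set.range g₁) ⊓ AddSubgroup.closure (Set.range g₂) ≤
      AddSubgroup.zmultiples (weight g₁ p)) :
    toricIdeal R (Sum.elim g₁ g₂) ≤ gluedIdeal R g₁ g₂ p q := by
  refine toricIdeal_le_iff.2 fun c c' hc => ?_
  obtain ⟨u, v, rfl⟩ : ∃ u v, sumElim u v = c :=
    ⟨_, _, Finsupp.comapDomain_sumElim_comapDomain c⟩
  obtain ⟨u', v', rfl⟩ : ∃ u v, sumElim u v = c' :=
    ⟨_, _, Finsupp.comapDomain_sumElim_comapDomain c'⟩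
  rw [weight_sumElim, weight_sumElim] at hc
  have hz₁ : weight g₁ u - weight g₁ u' ∈ AddSubgroup.closure (Set.range g₁) :=
    (mem_closure_range_iff_exists_weight_sub g₁ _).2 ⟨u, u', rfl⟩
  have hz₂ : weight g₁ u - weight g₁ u' ∈ AddSubgroup.closure (Set.range g₂) :=
    (mem_closure_range_iff_exists_weight_sub g₂ _).2 ⟨v', v, by grind⟩
  obtain ⟨k, hk⟩ := AddSubgroup.mem_zmultiples_iff.1 (h ⟨hz₁, hz₂⟩)
  obtain ⟨k, rfl | rfl⟩ := k.eq_nat_or_neg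
  · rw [natCast_zsmul] at hk
    exact monomial_sub_monomial_mem_gluedIdeal k (by grind) (by grind)
  · rw [neg_smul, natCast_zsmul] at hk
    rw [← neg_mem_iff, neg_sub]
    exact monomial_sub_monomial_mem_gluedIdeal k (by grind) (by grind)

theorem closure_inf_closure_le_zmultiples [Nontrivial R] {g₁ : ι₁ → G} {g₂ : ι₂ → G}
    {p : ι₁ →₀ ℕ} {q : ι₂ →₀ ℕ} (h : toricIdeal R (Sum.elim g₁ g₂) ≤ gluedIdeal R g₁ g₂ p q) :
    AddSubgroup.closure (Set.range g₁) ⊓ AddSubgroup.closure (Set.range g₂) ≤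
      AddSubgroup.zmultiples (weight g₁ p) := by
  rintro z ⟨hz₁, hz₂⟩
  obtain ⟨u, u', rfl⟩ := (mem_closure_range_iff_exists_weight_sub g₁ z).1 hz₁
  obtain ⟨v', v, hv⟩ := (mem_closure_range_iff_exists_weight_sub g₂ _).1 hz₂
  let π := QuotientAddGroup.mk' (AddSubgroup.zmultiples (weight g₁ p))
  have hπp : π (weight g₁ p) = 0 :=
    (QuotientAddGroup.eq_zero_iff _).2 (AddSubgroup.mem_zmultiples _)
  have hglued : gluedIdeal R g₁ g₂ p q ≤
      toricIdeal R (Sum.elim (π ∘ g₁) ((0 : G →+ _) ∘ g₂)) :=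
    gluedIdeal_le_toricIdeal_elim_comp π 0 hπp
  have hbinomial : monomial (sumElim u v) (1 : R) - monomial (sumElim u' v') 1 ∈
      toricIdeal R (Sum.elim g₁ g₂) := by
    refine monomial_sub_monomial_mem_toricIdeal ?_
    rw [weight_sumElim, weight_sumElim]
    grind
  have hπ : π (weight g₁ u) = π (weight g₁ u') := by
    simpa only [weight_sumElim, weight_comp, AddMonoidHom.zero_apply, add_zero] using
      monomial_sub_monomial_mem_toricIdeal_iff.1 (hglued (h hbinomial))
  exact QuotientAddGroup.eq_iff_sub_mem.1 hπ

theorem toricIdeal_elim_eq_gluedIdeal_iff [Nontrivial R] {g₁ : ι₁ → G} {g₂ : ι₂ → G}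
    {p : ι₁ →₀ ℕ} {q : ι₂ →₀ ℕ} :
    toricIdeal R (Sum.elim g₁ g₂) = gluedIdeal R g₁ g₂ p q ↔
      weight g₁ p = weight g₂ q ∧ AddSubgroup.zmultiples (weight g₁ p) =
        AddSubgroup.closure (Set.range g₁) ⊓ AddSubgroup.closure (Set.range g₂) := by
  constructor
  · intro h
    have hpq := weight_eq_of_gluedIdeal_le h.ge
    refine ⟨hpq, le_antisymm ?_ (closure_inf_closure_le_zmultiples h.le)⟩
    exact AddSubgroup.zmultiples_le_of_mem
      ⟨(mem_closure_range_iff_exists_weight_sub g₁ _).2 ⟨p, 0, by simp⟩,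
        (mem_closure_range_iff_exists_weight_sub g₂ _).2 ⟨q, 0, by simp [hpq]⟩⟩
  · rintro ⟨hpq, h⟩
    exact le_antisymm (toricIdeal_elim_le_gluedIdeal hpq h.ge)
      (gluedIdeal_le_toricIdeal_elim_comp (AddMonoidHom.id G) (AddMonoidHom.id G) hpq)

variable (R) in
/-- The analogue of `CanBeGlued` for families `s` and `t` of elements of an abelian group. The
condition `weight (a • s) p ≠ 0` says that `X^p` is not sent to `1`. -/
def FamiliesCanBeGlued (s : ι₁ → G) (t : ι₂ → G) : Prop :=
  ∃ a b : ℕ, 0 < a ∧ 0 < b ∧ ∃ (p : ι₁ →₀ ℕ) (q : ι₂ →₀ ℕ), weight (a • s) p ≠ 0 ∧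
    toricIdeal R (Sum.elim (a • s) (b • t)) = gluedIdeal R (a • s) (b • t) p q

end ToricIdeal

section IntegerLattice

variable {d : ℕ} (κ : Type*) [Field κ]

theorem toInt_injective : Function.Injective (toInt d) :=
  Finsupp.mapRange_injective _ (map_zero _) Nat.cast_injective

theorem toInt_comp_nsmul (a : ℕ) (g : ι → (Fin d →₀ ℕ)) :
    (toInt d ∘ fun i => a • g i) = a • (toInt d ∘ g) :=
  funext fun i => map_nsmul (toInt d) a (g i)

theorem map_toInt_scale_closure_range (a : ℕ) (g : ι → (Fin d →₀ ℕ)) :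
    (scale a (AddSubmonoid.closure (Set.range g))).map (toInt d) =
      AddSubmonoid.closure (Set.range (a • (toInt d ∘ g))) := by
  rw [scale, AddMonoidHom.map_mclosure, AddMonoidHom.map_mclosure, ← Set.range_comp,
    ← Set.range_comp, ← toInt_comp_nsmul]
  rfl

theorem gp_scale_closure_range (a : ℕ) (g : ι → (Fin d →₀ ℕ)) :
    gp (scale a (AddSubmonoid.closure (Set.range g))) =
      AddSubgroup.closure (Set.range (a • (toInt d ∘ g))) := by
  rw [gp, ← AddSubmonoid.coe_map, map_toInt_scale_closure_range]
  exact le_antisymm ((AddSubgroup.closure_le _).2 (AddSubgroup.le_closure_toAddSubmonoid _))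
    (AddSubgroup.closure_mono AddSubmonoid.subset_closure)

theorem ker_presentation (g : ι → (Fin d →₀ ℕ)) :
    RingHom.ker (presentation κ g) = toricIdeal κ (toInt d ∘ g) := by
  have hval : (Subalgebra.val _).comp (presentation κ g) = toricHom κ g := by
    ext i : 1
    rw [AlgHom.comp_apply, presentation, toricHom, aeval_X, aeval_X]
    rfl
  ext f
  rw [toricIdeal_comp_of_injective toInt_injective, toricIdeal, ← hval, RingHom.mem_ker,
    RingHom.mem_ker, AlgHom.comp_apply]
  exact ZeroMemClass.coe_eq_zero.symm

theorem presentation_monomial_eq_one_iff (g : ι → (Fin d →₀ ℕ)) (c : ι →₀ ℕ) :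
    presentation κ g (monomial c 1) = 1 ↔ weight (toInt d ∘ g) c = 0 := by
  rw [← sub_eq_zero, ← map_one (presentation κ g), ← map_sub, ← RingHom.mem_ker,
    ker_presentation, ← map_zero (weight (R := ℕ) (toInt d ∘ g))]
  exact monomial_sub_monomial_mem_toricIdeal_iff (R := κ) (c' := 0)

theorem canBeGlued_iff_familiesCanBeGlued {n m : ℕ}
    (s : Fin n → (Fin d →₀ ℕ)) (t : Fin m → (Fin d →₀ ℕ)) :
    CanBeGlued κ s t ↔ FamiliesCanBeGlued κ (toInt d ∘ s) (toInt d ∘ t) := by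
  simp only [CanBeGlued, FamiliesCanBeGlued, gluedIdeal, ne_eq, presentation_monomial_eq_one_iff,
    ker_presentation, Sum.comp_elim, toInt_comp_nsmul]

end IntegerLattice

end Gluing

open Gluing in
theorem theorem5p3_general (R : Type*) [CommRing R] [Nontrivial R] {ι₁ ι₂ G : Type*}
    [AddCommGroup G] (s : ι₁ → G) (t : ι₂ → G) :
    FamiliesCanBeGlued R s t ↔
      ∃ a b : ℕ, ∃ w ∈ AddSubmonoid.closure (Set.range (a • s)) ⊓
          AddSubmonoid.closure (Set.range (b • t)), w ≠ 0 ∧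
        AddSubgroup.zmultiples w =
          AddSubgroup.closure (Set.range (a • s)) ⊓ AddSubgroup.closure (Set.range (b • t)) := by
  simp only [FamiliesCanBeGlued, toricIdeal_elim_eq_gluedIdeal_iff, AddSubmonoid.mem_inf,
    AddSubmonoid.mem_closure_range_iff]
  constructor
  · rintro ⟨a, b, -, -, p, q, hp, hpq, hgp⟩
    exact ⟨a, b, _, ⟨⟨p, rfl⟩, ⟨q, hpq⟩⟩, hp, hgp⟩
  · rintro ⟨a, b, _, ⟨⟨p, rfl⟩, ⟨q, hpq⟩⟩, hp, hgp⟩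
    refine ⟨a, b, Nat.pos_of_ne_zero ?_, Nat.pos_of_ne_zero ?_, p, q, hp, hpq, hgp⟩
    · rintro rfl
      exact hp (by simp)
    · rintro rfl
      exact hp (hpq.trans (by simp))

theorem theorem5p3 (κ : Type*) [Field κ] {d n m : ℕ}
    (S₁ S₂ : AddSubmonoid (Fin d →₀ ℕ))
    (s : Fin n → (Fin d →₀ ℕ)) (hs : AddSubmonoid.closure (Set.range s) = S₁)
    (t : Fin m → (Fin d →₀ ℕ)) (ht : AddSubmonoid.closure (Set.range t) = S₂) :
    Gluing.CanBeGlued κ s t ↔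
      ∃ a b : ℕ, ∃ w ∈ Gluing.scale a S₁ ⊓ Gluing.scale b S₂, w ≠ 0 ∧
        AddSubgroup.zmultiples (Gluing.toInt d w) =
          Gluing.gp (Gluing.scale a S₁) ⊓ Gluing.gp (Gluing.scale b S₂) := by
  subst hs ht
  simp only [Gluing.canBeGlued_iff_familiesCanBeGlued, theorem5p3_general,
    Gluing.gp_scale_closure_range, ← Gluing.map_toInt_scale_closure_range,
    ← AddSubmonoid.map_inf _ _ _ Gluing.toInt_injective, AddSubmonoid.mem_map,
    exists_exists_and_eq_and, ne_eq, map_eq_zero_iff _ Gluing.toInt_injective]
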